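/- There is an absolute constant $c>0$ such that the following holds. Let $1\le n\le T$ be integers and let $L=(\alpha_1,\dots,\alpha_n)$ be a random real $T\times n$ matrix with columns $\alpha_1,\dots,\alpha_n\in\mathbb R^T$, whose entries $L_{ik}$ are independent and identically distributed with mean $0$, variance $v^2$ and subgaussian norm $$\|L_{ik}\|_{\psi_2}:=\sup_{p\ge 1}p^{-1/2}\left(\mathbb E|L_{ik}|^p\right)^{1/p}\le B,\qquad 0<B<\infty .$$ Fix $j\in\{1,\dots,n\}$ and assume that almost surely the columns $\alpha_k$, $k\ne j$, are linearly independent (in particular, this holds if almost surely all $n$ columns of $L$ are linearly independent). Let $R_{nn}=\|(I-\mathcal P_{L_j})\alpha_j\|_2$, where $\mathcal P_{L_j}$ is the orthogonal projection of $\mathbb R^T$ onto the span of the columns $\alpha_k$, $k\neq j$. Then for every $t>0$, $$\mathbb P\left(\left|R_{nn}^2-(T-n+1)v^2\right|>t\right)\le 2\exp\left(-c\,\min\left(\frac{t^2}{B^4(T-n+1)},\frac{t}{B^2}\right)\right).$$ -/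

import Mathlib

open MeasureTheory ProbabilityTheory

/-- The subgaussian norm `sup_{p ≥ 1} p^{-1/2} (E |X|^p)^{1/p}` (over real exponents `p ≥ 1`),
with values in `[0, ∞]`. -/
noncomputable def psi2Norm {Ω : Type*} [MeasurableSpace Ω] (X : Ω → ℝ) (P : Measure Ω) : ENNReal :=
  ⨆ (p : ℝ) (_ : 1 ≤ p), ENNReal.ofReal (p ^ (-(1 / 2) : ℝ)) * eLpNorm X (ENNReal.ofReal p) P

/-- The `k`-th column of a `T × n` real matrix, as a vector of Euclidean space. -/
noncomputable def euclideanCol {T n : ℕ} (A : Matrix (Fin T) (Fin n) ℝ) (k : Fin n) :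
    EuclideanSpace ℝ (Fin T) :=
  WithLp.toLp 2 (fun i => A i k)

/-- The span of all the columns of `A` except the `j`-th one, i.e. the column space of the matrix
obtained from `A` by deleting its `j`-th column. -/
noncomputable def otherColSpace {T n : ℕ} (A : Matrix (Fin T) (Fin n) ℝ) (j : Fin n) :
    Submodule ℝ (EuclideanSpace ℝ (Fin T)) :=
  Submodule.span ℝ (Set.range fun k : {k : Fin n // k ≠ j} => euclideanCol A k.1)

/-- `R_nn = ‖(I - P) α_j‖₂`, where `α_j` is the `j`-th column of `A` and `P` is the orthogonal
projection onto the span of the other columns. -/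
noncomputable def Rnn {T n : ℕ} (A : Matrix (Fin T) (Fin n) ℝ) (j : Fin n) : ℝ :=
  ‖euclideanCol A j - (otherColSpace A j).starProjection (euclideanCol A j)‖

/-!
The squared distance `R_nn²` of the column `α_j` to the span of the other columns is `‖U α_j‖²`,
where the rows of `U` are an orthonormal basis of the orthogonal complement of that span. Almost
surely the complement has dimension `d = T - n + 1`, and `U` is independent of `α_j`. By Fubini it
is enough to prove the Hanson–Wright inequality for the projection `Uᵀ U` with `U` fixed
(`measure_abs_sum_sq_sub_gt_le`).

All information on the entries is carried by two facts: they are centred, and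
`E exp (X² / β) ≤ 2` with `β = 12 B²`, which follows from the even moments in the subgaussian norm
(`lintegral_exp_sq_div_le_of_psi2Norm_le`). They give `E exp (a X) ≤ exp (a² β)` for all `a`
(`lintegral_exp_mul_le`), and `E exp (a (X² - E X²)) ≤ exp (44 a² β²)` for `|a| β ≤ 1 / 2`
(`lintegral_exp_mul_sq_sub_le`).

The centred quadratic form is split into its diagonal and its off-diagonal part. The diagonal part
is a sum of independent subexponential variables with weights `q_ii ∈ [0, 1]` whose sum is `d`
(`lintegral_exp_diag_le`). The off-diagonal part is an average over subsets `I` of bilinear forms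
between the coordinates in `I` and those in `Iᶜ` (`exp_mul_offDiag_le`). Integrating the
coordinates in `I` bounds such a block by `E exp (16 a² β ‖U y‖²)` with `y` supported on `Iᶜ`
(`lintegral_exp_block_le`). Writing the exponential of the square as a Gaussian average and
integrating `y` first turns this into `E exp (32 a² β² ‖g‖²)` for a standard Gaussian `g` in
`ℝ^d`, because `Uᵀ` is an isometry (`lintegral_exp_mul_sum_sq_le`). In total, the exponential moment
at `a` is at most `exp (256 a² β² d)` for `|a| β ≤ 1 / 24`, and the tail bound is Chernoff's.

Exponential moments are lower Lebesgue integrals throughout, so that Tonelli's theorem applies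
without integrability conditions.
-/

/-! ### Elementary inequalities for the exponential function -/

lemma Real.exp_le_self_add_exp_sq (x : ℝ) : Real.exp x ≤ x + Real.exp (x ^ 2) := by
  have h2 := Real.add_one_le_exp (x ^ 2)
  by_cases hx : |x| ≤ 1
  · have h1 := (abs_le.mp (Real.abs_exp_sub_one_sub_id_le hx)).2
    linarith
  · rcases lt_or_ge 0 x with h0 | h0
    · rw [abs_of_pos h0, not_le] at hx
      have : Real.exp x ≤ Real.exp (x ^ 2) := Real.exp_le_exp.mpr (by nlinarith)
      linarith
    · rw [abs_of_nonpos h0, not_le] at hx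
      have : Real.exp x ≤ 1 := Real.exp_le_one_iff.mpr h0
      nlinarith

lemma Real.exp_mul_le_one_add_mul_exp_sub_one {r : ℝ} (h0 : 0 ≤ r) (h1 : r ≤ 1) (y : ℝ) :
    Real.exp (r * y) ≤ 1 - r + r * Real.exp y := by
  have := convexOn_exp.2 (Set.mem_univ (0 : ℝ)) (Set.mem_univ y) (sub_nonneg.mpr h1) h0
    (by ring)
  simpa using this

/-- A second-order Taylor bound whose remainder is quadratic in the scale `r` with the full
exponential as its coefficient. -/
lemma Real.exp_mul_le_one_add_mul_add_sq_mul_exp_abs {r : ℝ} (hr : |r| ≤ 1 / 2) (z : ℝ) :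
    Real.exp (r * z) ≤ 1 + r * z + 8 * r ^ 2 * Real.exp |z| := by
  have h1 : Real.exp (r * z) - (1 + r * z) ≤ (r * z) ^ 2 * Real.exp |r * z| := by
    have := Complex.norm_exp_sub_sum_le_norm_mul_exp ((r * z : ℝ) : ℂ) 2
    rw [Finset.sum_range_succ, Finset.sum_range_one] at this
    simp only [pow_zero, pow_one, Nat.factorial_zero, Nat.factorial_one, Nat.cast_one,
      div_one] at this
    rw [← Complex.ofReal_exp, ← Complex.ofReal_one, ← Complex.ofReal_add, ← Complex.ofReal_sub,
      Complex.norm_real, Complex.norm_real, Real.norm_eq_abs, Real.norm_eq_abs, sq_abs] at this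
    exact (le_abs_self _).trans this
  have h2 : |r * z| ≤ |z| / 2 := by
    rw [abs_mul]
    nlinarith [abs_nonneg z]
  have h3 : Real.exp |r * z| ≤ Real.exp (|z| / 2) := Real.exp_le_exp.mpr h2
  have h4 : z ^ 2 ≤ 8 * Real.exp (|z| / 2) := by
    have := Real.pow_div_factorial_le_exp (x := |z| / 2) (by positivity) 2
    rw [div_pow, sq_abs] at this
    norm_num at this
    linarith
  have h5 : Real.exp |z| = Real.exp (|z| / 2) * Real.exp (|z| / 2) := by
    rw [← Real.exp_add]; ring_nf
  have h6 : z ^ 2 * Real.exp |r * z| ≤ 8 * Real.exp |z| := by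
    rw [h5, ← mul_assoc]
    exact mul_le_mul h4 h3 (Real.exp_pos _).le (by positivity)
  have h7 := mul_le_mul_of_nonneg_left h6 (sq_nonneg r)
  nlinarith

/-! ### Moment generating functions of a subgaussian law and of its square -/

section OneDim

variable {μ : Measure ℝ} {β : ℝ}

lemma integrable_exp_sq_div
    (h : ∫⁻ x, ENNReal.ofReal (Real.exp (x ^ 2 / β)) ∂μ ≤ 2) :
    Integrable (fun x => Real.exp (x ^ 2 / β)) μ := by
  refine ⟨by fun_prop, ?_⟩
  rw [hasFiniteIntegral_iff_ofReal (Filter.Eventually.of_forall fun x => (Real.exp_pos _).le)]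
  exact h.trans_lt (by simp)

lemma integral_exp_sq_div_le (h : ∫⁻ x, ENNReal.ofReal (Real.exp (x ^ 2 / β)) ∂μ ≤ 2) :
    ∫ x, Real.exp (x ^ 2 / β) ∂μ ≤ 2 := by
  rw [integral_eq_lintegral_of_nonneg_ae
    (Filter.Eventually.of_forall fun x => (Real.exp_pos _).le) (by fun_prop)]
  exact ENNReal.toReal_le_of_le_ofReal (by norm_num) (by simpa using h)

lemma integrable_sq_of_exp (hβ : 0 < β)
    (h : ∫⁻ x, ENNReal.ofReal (Real.exp (x ^ 2 / β)) ∂μ ≤ 2) :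
    Integrable (fun x : ℝ => x ^ 2) μ := by
  refine ((integrable_exp_sq_div h).const_mul β).mono' (by fun_prop) ?_
  refine Filter.Eventually.of_forall fun x => ?_
  rw [Real.norm_eq_abs, abs_of_nonneg (sq_nonneg x)]
  have := Real.add_one_le_exp (x ^ 2 / β)
  have h2 : x ^ 2 / β ≤ Real.exp (x ^ 2 / β) := by linarith
  rwa [div_le_iff₀' hβ] at h2

variable [IsProbabilityMeasure μ]

lemma integrable_id_of_exp (hβ : 0 < β)
    (h : ∫⁻ x, ENNReal.ofReal (Real.exp (x ^ 2 / β)) ∂μ ≤ 2) :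
    Integrable (fun x : ℝ => x) μ := by
  refine ((integrable_sq_of_exp hβ h).add (integrable_const 1)).mono' (by fun_prop) ?_
  refine Filter.Eventually.of_forall fun x => ?_
  simp only [Real.norm_eq_abs, Pi.add_apply]
  nlinarith [sq_abs x, sq_nonneg (|x| - 1)]

lemma integral_sq_le_of_exp (hβ : 0 < β)
    (h : ∫⁻ x, ENNReal.ofReal (Real.exp (x ^ 2 / β)) ∂μ ≤ 2) :
    ∫ x, x ^ 2 ∂μ ≤ β := by
  have h1 : ∫ x, (x ^ 2 / β + 1) ∂μ ≤ ∫ x, Real.exp (x ^ 2 / β) ∂μ :=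
    integral_mono (((integrable_sq_of_exp hβ h).div_const β).add (integrable_const 1))
      (integrable_exp_sq_div h) fun x => Real.add_one_le_exp _
  rw [integral_add ((integrable_sq_of_exp hβ h).div_const β) (integrable_const 1),
    integral_div] at h1
  have h2 := integral_exp_sq_div_le h
  have h3 : (∫ x, x ^ 2 ∂μ) / β ≤ 1 := by
    simp at h1
    linarith
  rwa [div_le_one hβ] at h3

/-- A nonnegative function bounded by a constant, a centred term and a multiple of `exp (x² / β)`
has expectation bounded by the constant plus twice the multiple. -/
lemma lintegral_ofReal_le_of_le_add_exp_sq
    (h : ∫⁻ x, ENNReal.ofReal (Real.exp (x ^ 2 / β)) ∂μ ≤ 2)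
    {f g : ℝ → ℝ} {a r : ℝ} (hr : 0 ≤ r) (hg : Integrable g μ) (hg0 : ∫ x, g x ∂μ = 0)
    (hf : ∀ x, 0 ≤ f x) (hfg : ∀ x, f x ≤ a + g x + r * Real.exp (x ^ 2 / β)) :
    ∫⁻ x, ENNReal.ofReal (f x) ∂μ ≤ ENNReal.ofReal (a + 2 * r) := by
  have hag : Integrable (fun x => a + g x) μ := (integrable_const a).add hg
  have hre : Integrable (fun x => r * Real.exp (x ^ 2 / β)) μ :=
    (integrable_exp_sq_div h).const_mul r
  calc ∫⁻ x, ENNReal.ofReal (f x) ∂μ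
      ≤ ∫⁻ x, ENNReal.ofReal (a + g x + r * Real.exp (x ^ 2 / β)) ∂μ :=
        lintegral_mono fun x => ENNReal.ofReal_le_ofReal (hfg x)
    _ = ENNReal.ofReal (∫ x, (a + g x + r * Real.exp (x ^ 2 / β)) ∂μ) :=
        (ofReal_integral_eq_lintegral_ofReal (hag.add hre)
          (Filter.Eventually.of_forall fun x => (hf x).trans (hfg x))).symm
    _ ≤ ENNReal.ofReal (a + 2 * r) := by
        refine ENNReal.ofReal_le_ofReal ?_
        rw [integral_add hag hre, integral_add (integrable_const a) hg, hg0,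
          integral_const_mul]
        simp only [integral_const, probReal_univ, add_zero, smul_eq_mul, one_mul]
        nlinarith [integral_exp_sq_div_le h]

/-- A centred law with `E exp (x² / β) ≤ 2` is subgaussian with variance proxy `2β`. -/
lemma lintegral_exp_mul_le (hβ : 0 < β)
    (h : ∫⁻ x, ENNReal.ofReal (Real.exp (x ^ 2 / β)) ∂μ ≤ 2) (h0 : ∫ x, x ∂μ = 0) (a : ℝ) :
    ∫⁻ x, ENNReal.ofReal (Real.exp (a * x)) ∂μ ≤ ENNReal.ofReal (Real.exp (a ^ 2 * β)) := by
  have ha : 0 ≤ a ^ 2 * β := by positivity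
  rcases le_total (a ^ 2 * β) 1 with h1 | h1
  · refine (lintegral_ofReal_le_of_le_add_exp_sq (a := 1 - a ^ 2 * β) (r := a ^ 2 * β)
      (g := fun x => a * x) h ha ((integrable_id_of_exp hβ h).const_mul a)
      (by rw [integral_const_mul, h0, mul_zero]) (fun x => (Real.exp_pos _).le) fun x => ?_).trans
      (ENNReal.ofReal_le_ofReal ?_)
    · have e1 := Real.exp_le_self_add_exp_sq (a * x)
      have e2 := Real.exp_mul_le_one_add_mul_exp_sub_one ha h1 (x ^ 2 / β)
      have e3 : a ^ 2 * β * (x ^ 2 / β) = (a * x) ^ 2 := by field_simp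
      rw [e3] at e2
      linarith
    · have := Real.add_one_le_exp (a ^ 2 * β)
      linarith
  · -- For large `a` the quadratic bound `a x ≤ (a² β + x² / β) / 2` is enough.
    refine (lintegral_ofReal_le_of_le_add_exp_sq (a := Real.exp (a ^ 2 * β / 2) * (1 / 2))
      (r := Real.exp (a ^ 2 * β / 2) * (1 / 2))
      (g := fun _ => 0) h (by positivity) (integrable_zero _ _ _)
      (by simp) (fun x => (Real.exp_pos _).le) fun x => ?_).trans
      (ENNReal.ofReal_le_ofReal ?_)
    · have e2 := Real.exp_mul_le_one_add_mul_exp_sub_one (r := 1 / 2) (by norm_num) (by norm_num)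
        (x ^ 2 / β)
      have e3 : a * x ≤ a ^ 2 * β / 2 + 1 / 2 * (x ^ 2 / β) := by
        have : a ^ 2 * β / 2 + 1 / 2 * (x ^ 2 / β) - a * x = (a * β - x) ^ 2 / (2 * β) := by
          field_simp
          ring
        have h' : 0 ≤ (a * β - x) ^ 2 / (2 * β) := by positivity
        linarith
      calc Real.exp (a * x) ≤ Real.exp (a ^ 2 * β / 2 + 1 / 2 * (x ^ 2 / β)) :=
            Real.exp_le_exp.mpr e3
        _ = Real.exp (a ^ 2 * β / 2) * Real.exp (1 / 2 * (x ^ 2 / β)) := Real.exp_add _ _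
        _ ≤ Real.exp (a ^ 2 * β / 2) * (1 - 1 / 2 + 1 / 2 * Real.exp (x ^ 2 / β)) :=
            mul_le_mul_of_nonneg_left e2 (Real.exp_pos _).le
        _ = _ := by ring
    · have e1 : Real.exp (a ^ 2 * β) = Real.exp (a ^ 2 * β / 2) * Real.exp (a ^ 2 * β / 2) := by
        rw [← Real.exp_add]; ring_nf
      have e2 := Real.add_one_le_exp (a ^ 2 * β / 2)
      have e3 : 3 / 2 ≤ Real.exp (a ^ 2 * β / 2) := by linarith
      rw [e1]
      nlinarith [Real.exp_pos (a ^ 2 * β / 2)]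

/-- Under `E exp (x² / β) ≤ 2` the centred square is subexponential. -/
lemma lintegral_exp_mul_sq_sub_le (hβ : 0 < β)
    (h : ∫⁻ x, ENNReal.ofReal (Real.exp (x ^ 2 / β)) ∂μ ≤ 2) {m : ℝ} (hm : ∫ x, x ^ 2 ∂μ = m)
    {a : ℝ} (ha : |a| * β ≤ 1 / 2) :
    ∫⁻ x, ENNReal.ofReal (Real.exp (a * (x ^ 2 - m))) ∂μ ≤
      ENNReal.ofReal (Real.exp (44 * a ^ 2 * β ^ 2)) := by
  have hm0 : 0 ≤ m := hm ▸ integral_nonneg fun x => sq_nonneg x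
  have hmβ : m ≤ β := hm ▸ integral_sq_le_of_exp hβ h
  have hsq := integrable_sq_of_exp hβ h
  refine (lintegral_ofReal_le_of_le_add_exp_sq (a := 1) (r := 22 * (a * β) ^ 2)
      (g := fun x => a * (x ^ 2 - m)) h (by positivity)
      ((hsq.sub (integrable_const m)).const_mul a)
      ?_ (fun x => (Real.exp_pos _).le) fun x => ?_).trans
      (ENNReal.ofReal_le_ofReal ?_)
  · rw [integral_const_mul, integral_sub hsq (integrable_const m), hm]
    simp
  · have e1 := Real.exp_mul_le_one_add_mul_add_sq_mul_exp_abs (r := a * β)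
      (by rwa [abs_mul, abs_of_pos hβ]) ((x ^ 2 - m) / β)
    have e2 : a * β * ((x ^ 2 - m) / β) = a * (x ^ 2 - m) := by field_simp
    rw [e2] at e1
    have e3 : |(x ^ 2 - m) / β| ≤ 1 + x ^ 2 / β := by
      have hmd : m / β ≤ 1 := (div_le_one hβ).mpr hmβ
      have hmd0 : 0 ≤ m / β := by positivity
      have hx0 : 0 ≤ x ^ 2 / β := by positivity
      rw [sub_div, abs_le]
      constructor <;> linarith
    have e4 : Real.exp |(x ^ 2 - m) / β| ≤ 2.75 * Real.exp (x ^ 2 / β) := by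
      refine (Real.exp_le_exp.mpr e3).trans ?_
      rw [Real.exp_add]
      have := Real.exp_one_lt_d9
      exact mul_le_mul_of_nonneg_right (by linarith) (Real.exp_pos _).le
    have e5 := mul_le_mul_of_nonneg_left e4 (by positivity : 0 ≤ 8 * (a * β) ^ 2)
    linarith
  · have := Real.add_one_le_exp (44 * a ^ 2 * β ^ 2)
    nlinarith

end OneDim

/-- The square of a standard Gaussian is subexponential. -/
lemma lintegral_exp_mul_sq_gaussianReal_le {u : ℝ} (h0 : 0 ≤ u) (hu : u ≤ 1 / 4) :
    ∫⁻ x, ENNReal.ofReal (Real.exp (u * x ^ 2)) ∂(gaussianReal 0 1) ≤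
      ENNReal.ofReal (Real.exp (2 * u)) := by
  have hpos : 0 < 1 / 2 - u := by linarith
  have hf : Measurable (fun x : ℝ => ENNReal.ofReal (Real.exp (u * x ^ 2))) := by fun_prop
  rw [gaussianReal_of_var_ne_zero _ one_ne_zero,
    lintegral_withDensity_eq_lintegral_mul _ (measurable_gaussianPDF 0 1) hf]
  have key : ∀ x : ℝ, (gaussianPDF 0 1 * fun x : ℝ => ENNReal.ofReal (Real.exp (u * x ^ 2))) x =
      ENNReal.ofReal ((√(2 * Real.pi))⁻¹ * Real.exp (-(1 / 2 - u) * x ^ 2)) := by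
    intro x
    rw [Pi.mul_apply, gaussianPDF, ← ENNReal.ofReal_mul (gaussianPDFReal_nonneg _ _ _),
      gaussianPDFReal, mul_assoc, ← Real.exp_add]
    congr 2
    · simp
    · congr 1
      simp
      ring
  simp_rw [key]
  rw [← ofReal_integral_eq_lintegral_ofReal ((integrable_exp_neg_mul_sq hpos).const_mul _)
    (Filter.Eventually.of_forall fun x => by positivity), integral_const_mul, integral_gaussian]
  refine ENNReal.ofReal_le_ofReal ?_
  -- It remains to see that `(1 - 2u)⁻¹ ≤ exp (4u)`.
  rw [← Real.sqrt_inv, ← Real.sqrt_mul (by positivity)]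
  refine Real.sqrt_le_iff.mpr ⟨(Real.exp_pos _).le, ?_⟩
  rw [← Real.exp_nat_mul]
  have e1 := Real.add_one_le_exp (4 * u)
  have e2 : (2 * Real.pi)⁻¹ * (Real.pi / (1 / 2 - u)) = (1 - 2 * u)⁻¹ := by
    have := Real.pi_pos
    have h' : 1 - 2 * u ≠ 0 := by linarith
    have h'' : 1 / 2 - u ≠ 0 := hpos.ne'
    field_simp
  rw [e2]
  have e3 : (1 - 2 * u)⁻¹ ≤ 1 + 4 * u := by
    rw [inv_le_iff_one_le_mul₀ (by linarith)]
    nlinarith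
  refine e3.trans ?_
  push_cast
  have : 2 * (2 * u) = 4 * u := by ring
  rw [this]; linarith

/-! ### Products -/

lemma lintegral_pi_prod {κ : Type*} [Fintype κ] (μ : Measure ℝ) [IsProbabilityMeasure μ]
    {f : κ → ℝ → ENNReal} (hf : ∀ k, Measurable (f k)) :
    ∫⁻ y, ∏ k, f k (y k) ∂(Measure.pi fun _ : κ => μ) = ∏ k, ∫⁻ x, f k x ∂μ := by
  have hind : iIndepFun (fun (k : κ) (y : κ → ℝ) => f k (y k)) (Measure.pi fun _ : κ => μ) :=
    iIndepFun_pi (μ := fun _ : κ => μ) (X := fun k x => f k x) fun k => (hf k).aemeasurable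
  rw [lintegral_prod_eq_prod_lintegral_of_indepFun _ _ hind fun k =>
    (hf k).comp (measurable_pi_apply k)]
  refine Finset.prod_congr rfl fun k _ => ?_
  exact (measurePreserving_eval (fun _ : κ => μ) k).lintegral_comp (hf k)

/-- Independent coordinates: a bound on each one-dimensional exponential moment gives a bound on
the exponential moment of the sum. -/
lemma lintegral_pi_exp_sum_le {κ : Type*} [Fintype κ] (μ : Measure ℝ) [IsProbabilityMeasure μ]
    {f : κ → ℝ → ℝ} {b : κ → ℝ} (hf : ∀ k, Measurable (f k))
    (hb : ∀ k, ∫⁻ x, ENNReal.ofReal (Real.exp (f k x)) ∂μ ≤ ENNReal.ofReal (Real.exp (b k))) :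
    ∫⁻ y, ENNReal.ofReal (Real.exp (∑ k, f k (y k))) ∂(Measure.pi fun _ : κ => μ) ≤
      ENNReal.ofReal (Real.exp (∑ k, b k)) := by
  have e : ∀ z : κ → ℝ, ENNReal.ofReal (Real.exp (∑ k, z k)) =
      ∏ k, ENNReal.ofReal (Real.exp (z k)) := fun z => by
    rw [Real.exp_sum, ENNReal.ofReal_prod_of_nonneg fun k _ => (Real.exp_pos _).le]
  simp_rw [e]
  rw [lintegral_pi_prod μ (f := fun k x => ENNReal.ofReal (Real.exp (f k x)))
    fun k => by have := hf k; fun_prop]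
  exact Finset.prod_le_prod' fun k _ => hb k

/-! ### Exponential moments of coisometric images -/

section Coisometry

variable {μ : Measure ℝ} [IsProbabilityMeasure μ] {β : ℝ}

lemma lintegral_pi_exp_linear_le {κ : Type*} [Fintype κ] (hβ : 0 < β)
    (h : ∫⁻ x, ENNReal.ofReal (Real.exp (x ^ 2 / β)) ∂μ ≤ 2) (h0 : ∫ x, x ∂μ = 0) (a : κ → ℝ) :
    ∫⁻ y, ENNReal.ofReal (Real.exp (∑ k, a k * y k)) ∂(Measure.pi fun _ : κ => μ) ≤
      ENNReal.ofReal (Real.exp ((∑ k, a k ^ 2) * β)) := by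
  rw [Finset.sum_mul]
  exact lintegral_pi_exp_sum_le μ (f := fun k x => a k * x) (fun k => by fun_prop)
    fun k => lintegral_exp_mul_le hβ h h0 (a k)

/-- The quadratic exponential `exp (s ‖w‖²)` is the Gaussian average of the linear exponentials
`exp (√(2s) ⟪g, w⟫)`. -/
lemma exp_mul_sum_sq_eq_lintegral_gaussian {σ : Type*} [Fintype σ] {s : ℝ} (hs : 0 ≤ s)
    (w : σ → ℝ) :
    ENNReal.ofReal (Real.exp (s * ∑ l, w l ^ 2)) =
      ∫⁻ g, ENNReal.ofReal (Real.exp (∑ l, √(2 * s) * w l * g l))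
        ∂(Measure.pi fun _ : σ => gaussianReal 0 1) := by
  have e : ∀ z : σ → ℝ, ENNReal.ofReal (Real.exp (∑ k, z k)) =
      ∏ k, ENNReal.ofReal (Real.exp (z k)) := fun z => by
    rw [Real.exp_sum, ENNReal.ofReal_prod_of_nonneg fun k _ => (Real.exp_pos _).le]
  rw [Finset.mul_sum]
  simp_rw [e]
  rw [lintegral_pi_prod (gaussianReal 0 1)
    (f := fun l x => ENNReal.ofReal (Real.exp (√(2 * s) * w l * x))) fun l => by fun_prop]
  refine Finset.prod_congr rfl fun l _ => ?_
  rw [← ofReal_integral_eq_lintegral_ofReal (integrable_exp_mul_gaussianReal _)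
    (Filter.Eventually.of_forall fun x => (Real.exp_pos _).le)]
  have := mgf_gaussianReal (p := gaussianReal 0 1) (X := id) Measure.map_id (√(2 * s) * w l)
  rw [mgf] at this
  simp only [id] at this
  rw [this, mul_pow, Real.sq_sqrt (by positivity)]
  congr 2
  push_cast
  ring

/-- If `uᵀ` is a contraction then `‖u y‖²`, for `y` with independent centred subgaussian
coordinates, has exponential moments like those of a `σ`-dimensional Gaussian: after Gaussian
linearization, integrating in `y` leaves `exp (2 s β ‖uᵀ g‖²) ≤ exp (2 s β ‖g‖²)`. -/
lemma lintegral_exp_mul_sum_sq_le {σ κ : Type*} [Fintype σ] [Fintype κ] (hβ : 0 < β)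
    (h : ∫⁻ x, ENNReal.ofReal (Real.exp (x ^ 2 / β)) ∂μ ≤ 2) (h0 : ∫ x, x ∂μ = 0)
    (u : σ → κ → ℝ) (hu : ∀ g : σ → ℝ, ∑ k, (∑ l, g l * u l k) ^ 2 ≤ ∑ l, g l ^ 2)
    {s : ℝ} (hs : 0 ≤ s) (hsβ : s * β ≤ 1 / 8) :
    ∫⁻ y, ENNReal.ofReal (Real.exp (s * ∑ l, (∑ k, u l k * y k) ^ 2))
        ∂(Measure.pi fun _ : κ => μ) ≤
      ENNReal.ofReal (Real.exp (4 * s * β * Fintype.card σ)) := by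
  simp_rw [exp_mul_sum_sq_eq_lintegral_gaussian hs]
  rw [lintegral_lintegral_swap (by fun_prop)]
  calc ∫⁻ g, ∫⁻ y, ENNReal.ofReal (Real.exp (∑ l, √(2 * s) * (∑ k, u l k * y k) * g l))
          ∂(Measure.pi fun _ : κ => μ) ∂(Measure.pi fun _ : σ => gaussianReal 0 1)
      ≤ ∫⁻ g, ENNReal.ofReal (Real.exp (∑ l, 2 * s * β * g l ^ 2))
          ∂(Measure.pi fun _ : σ => gaussianReal 0 1) := by
        refine lintegral_mono fun g => ?_
        have e : ∀ y : κ → ℝ, ∑ l, √(2 * s) * (∑ k, u l k * y k) * g l =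
            ∑ k, (√(2 * s) * ∑ l, g l * u l k) * y k := by
          intro y
          simp_rw [Finset.mul_sum, Finset.sum_mul]
          rw [Finset.sum_comm]
          exact Finset.sum_congr rfl fun k _ => Finset.sum_congr rfl fun l _ => by ring
        simp_rw [e]
        refine (lintegral_pi_exp_linear_le hβ h h0 _).trans (ENNReal.ofReal_le_ofReal ?_)
        refine Real.exp_le_exp.mpr ?_
        simp_rw [mul_pow, Real.sq_sqrt (by positivity : 0 ≤ 2 * s)]
        rw [← Finset.mul_sum, ← Finset.mul_sum]
        have := mul_le_mul_of_nonneg_left (hu g) (by positivity : 0 ≤ 2 * s * β)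
        linarith
    _ ≤ ENNReal.ofReal (Real.exp (∑ _l : σ, 2 * (2 * s * β))) :=
        lintegral_pi_exp_sum_le (gaussianReal 0 1) (f := fun _ x => 2 * s * β * x ^ 2)
          (fun l => by fun_prop) fun l => lintegral_exp_mul_sq_gaussianReal_le (by positivity)
            (by linarith)
    _ = _ := by
        rw [Finset.sum_const, Finset.card_univ, nsmul_eq_mul]
        ring_nf

end Coisometry

/-! ### Decoupling -/

/-- For `i ≠ k`, exactly a quarter of the subsets contain `i` but not `k`. -/
lemma four_mul_sum_finset_mem_notMem {ι : Type*} [Fintype ι] [DecidableEq ι] {i k : ι}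
    (hik : i ≠ k) :
    4 * ∑ I : Finset ι, (if i ∈ I ∧ k ∉ I then (1 : ℝ) else 0) = 2 ^ Fintype.card ι := by
  have flip : ∀ (a : ι) (f : Finset ι → ℝ), ∑ I, f (symmDiff {a} I) = ∑ I, f I := fun a f =>
    (symmDiff_right_involutive {a}).bijective.sum_comp f
  have h1 : ∑ I : Finset ι, (if i ∈ I ∧ k ∉ I then (1 : ℝ) else 0) =
      ∑ I : Finset ι, (if i ∉ I ∧ k ∉ I then (1 : ℝ) else 0) := by
    rw [← flip i]
    refine Finset.sum_congr rfl fun I _ => ?_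
    simp [Finset.mem_symmDiff, hik.symm]
  have h2 : ∑ I : Finset ι, (if k ∈ I then (1 : ℝ) else 0) =
      ∑ I : Finset ι, (if k ∉ I then (1 : ℝ) else 0) := by
    rw [← flip k]
    refine Finset.sum_congr rfl fun I _ => ?_
    simp [Finset.mem_symmDiff]
  have h3 : ∑ I : Finset ι, (if k ∉ I then (1 : ℝ) else 0) =
      ∑ I : Finset ι, (if i ∈ I ∧ k ∉ I then (1 : ℝ) else 0) +
      ∑ I : Finset ι, (if i ∉ I ∧ k ∉ I then (1 : ℝ) else 0) := by
    rw [← Finset.sum_add_distrib]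
    refine Finset.sum_congr rfl fun I _ => ?_
    by_cases hi : i ∈ I <;> by_cases hk : k ∈ I <;> simp [hi, hk]
  have h4 : (2 : ℝ) ^ Fintype.card ι = ∑ I : Finset ι, (if k ∈ I then (1 : ℝ) else 0) +
      ∑ I : Finset ι, (if k ∉ I then (1 : ℝ) else 0) := by
    rw [← Finset.sum_add_distrib]
    have : ∀ I : Finset ι, ((if k ∈ I then (1 : ℝ) else 0) + if k ∉ I then (1 : ℝ) else 0) = 1 := by
      intro I
      by_cases hk : k ∈ I <;> simp [hk]
    simp_rw [this]
    simp
  linarith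

lemma sum_ite_mem_notMem_eq {ι : Type*} [Fintype ι] [DecidableEq ι] (I : Finset ι)
    (f : ι → ι → ℝ) :
    ∑ i, ∑ k, (if i ∈ I ∧ k ∉ I then f i k else 0) =
      ∑ i : {i // i ∈ I}, ∑ k : {k // ¬ k ∈ I}, f i k := by
  have e1 : ∀ i, ∑ k : {k // ¬ k ∈ I}, f i k = ∑ k, if k ∉ I then f i k else 0 := fun i => by
    rw [← Finset.sum_filter]
    exact (Finset.sum_subtype _ (by simp) _).symm
  have e2 : ∀ F : ι → ℝ, ∑ i : {i // i ∈ I}, F i = ∑ i, if i ∈ I then F i else 0 := fun F => by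
    rw [← Finset.sum_filter]
    exact (Finset.sum_subtype _ (by simp) _).symm
  simp_rw [e1]
  rw [e2 fun i => ∑ k, if k ∉ I then f i k else 0]
  refine Finset.sum_congr rfl fun i _ => ?_
  by_cases hi : i ∈ I <;> simp [hi]

/-- Decoupling: an off-diagonal sum is four times the average, over all subsets `I`, of its
restrictions to `I × Iᶜ`; the inequality is Jensen's for this average. -/
lemma exp_mul_offDiag_le {ι : Type*} [Fintype ι] [DecidableEq ι] (f : ι → ι → ℝ) (a : ℝ) :
    Real.exp (a * ∑ i, ∑ k, if i = k then 0 else f i k) ≤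
      ∑ I : Finset ι, ((2 : ℝ) ^ Fintype.card ι)⁻¹ *
        Real.exp (4 * a * ∑ i : {i // i ∈ I}, ∑ k : {k // ¬ k ∈ I}, f i k) := by
  have hN : (0 : ℝ) < 2 ^ Fintype.card ι := by positivity
  have key : a * ∑ i, ∑ k, (if i = k then 0 else f i k) =
      ∑ I : Finset ι, ((2 : ℝ) ^ Fintype.card ι)⁻¹ •
        (4 * a * ∑ i : {i // i ∈ I}, ∑ k : {k // ¬ k ∈ I}, f i k) := by
    simp_rw [← sum_ite_mem_notMem_eq, smul_eq_mul]
    rw [← Finset.mul_sum, ← Finset.mul_sum,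
      Finset.sum_comm (s := (Finset.univ : Finset (Finset ι)))]
    have e : ∀ i, ∑ I : Finset ι, ∑ k, (if i ∈ I ∧ k ∉ I then f i k else 0) =
        (2 : ℝ) ^ Fintype.card ι / 4 * ∑ k, if i = k then 0 else f i k := by
      intro i
      rw [Finset.sum_comm, Finset.mul_sum]
      refine Finset.sum_congr rfl fun k _ => ?_
      by_cases hik : i = k
      · subst hik
        simp
      · rw [if_neg hik, ← four_mul_sum_finset_mem_notMem hik]
        rw [mul_div_cancel_left₀ _ (four_ne_zero' ℝ), Finset.sum_mul]
        simp only [ite_mul, one_mul, zero_mul]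
    simp_rw [e]
    rw [← Finset.mul_sum]
    field_simp
  rw [key]
  exact convexOn_exp.map_sum_le (fun I _ => by positivity) (by simp) fun I _ => Set.mem_univ _

/-! ### Concentration of the squared norm of a coisometric image -/

section HansonWright

variable {μ : Measure ℝ} [IsProbabilityMeasure μ] {β : ℝ}
variable {σ ι : Type*} [Fintype σ] [Fintype ι] {U : σ → ι → ℝ}

lemma sum_row_sq_eq_one (hU : ∀ g : σ → ℝ, ∑ k, (∑ l, g l * U l k) ^ 2 = ∑ l, g l ^ 2) (l : σ) :
    ∑ k, U l k ^ 2 = 1 := by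
  classical
  have := hU (Pi.single l 1)
  simpa [Pi.single_apply, ite_pow] using this

/-- The trace of the projection `Uᵀ U`. -/
lemma sum_sum_sq_eq_card (hU : ∀ g : σ → ℝ, ∑ k, (∑ l, g l * U l k) ^ 2 = ∑ l, g l ^ 2) :
    ∑ i, ∑ l, U l i * U l i = Fintype.card σ := by
  rw [Finset.sum_comm]
  simp_rw [← sq, sum_row_sq_eq_one hU]
  simp

lemma diag_sq_le_diag (hU : ∀ g : σ → ℝ, ∑ k, (∑ l, g l * U l k) ^ 2 = ∑ l, g l ^ 2) (i : ι) :
    (∑ l, U l i * U l i) ^ 2 ≤ ∑ l, U l i * U l i := by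
  have h1 := hU fun l => U l i
  have h2 := Finset.single_le_sum (f := fun k => (∑ l, U l i * U l k) ^ 2)
    (fun k _ => sq_nonneg _) (Finset.mem_univ i)
  rw [h1] at h2
  simpa only [sq (U _ _)] using h2

/-- The diagonal part of the quadratic form is a weighted sum of independent subexponential
variables, with weights in `[0, 1]` adding up to the rank. -/
lemma lintegral_exp_diag_le (hU : ∀ g : σ → ℝ, ∑ k, (∑ l, g l * U l k) ^ 2 = ∑ l, g l ^ 2)
    (hβ : 0 < β) (h : ∫⁻ x, ENNReal.ofReal (Real.exp (x ^ 2 / β)) ∂μ ≤ 2) {m : ℝ}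
    (hm : ∫ x, x ^ 2 ∂μ = m) {a : ℝ} (ha : |a| * β ≤ 1 / 2) :
    ∫⁻ y, ENNReal.ofReal (Real.exp (∑ i, a * (∑ l, U l i * U l i) * (y i ^ 2 - m)))
        ∂(Measure.pi fun _ : ι => μ) ≤
      ENNReal.ofReal (Real.exp (44 * a ^ 2 * β ^ 2 * Fintype.card σ)) := by
  have hq0 : ∀ i, 0 ≤ ∑ l, U l i * U l i := fun i =>
    Finset.sum_nonneg fun l _ => mul_self_nonneg _
  have hq1 : ∀ i, ∑ l, U l i * U l i ≤ 1 := fun i => by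
    nlinarith [diag_sq_le_diag hU i, hq0 i]
  refine (lintegral_pi_exp_sum_le μ
    (f := fun i x => a * (∑ l, U l i * U l i) * (x ^ 2 - m)) (fun i => by fun_prop)
    fun i => lintegral_exp_mul_sq_sub_le hβ h hm ?_).trans
    (ENNReal.ofReal_le_ofReal (Real.exp_le_exp.mpr ?_))
  · rw [abs_mul, abs_of_nonneg (hq0 i)]
    nlinarith [mul_le_mul_of_nonneg_left (hq1 i) (by positivity : 0 ≤ |a| * β)]
  · rw [← sum_sum_sq_eq_card hU, Finset.mul_sum]
    refine Finset.sum_le_sum fun i _ => ?_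
    have := mul_le_mul_of_nonneg_left (diag_sq_le_diag hU i)
      (by positivity : 0 ≤ 44 * a ^ 2 * β ^ 2)
    linarith

/-- One decoupled block of the off-diagonal part. Integrating the coordinates in `I` leaves the
exponential of a multiple of the squared norm of the `I`-part of `Uᵀ U y`, where `y` is supported
on `Iᶜ`; this is at most `‖U y‖²`. -/
lemma lintegral_exp_block_le [DecidableEq ι]
    (hU : ∀ g : σ → ℝ, ∑ k, (∑ l, g l * U l k) ^ 2 = ∑ l, g l ^ 2)
    (hβ : 0 < β) (h : ∫⁻ x, ENNReal.ofReal (Real.exp (x ^ 2 / β)) ∂μ ≤ 2)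
    (h0 : ∫ x, x ∂μ = 0) {a : ℝ} (ha : |a| * β ≤ 1 / 12) (I : Finset ι) :
    ∫⁻ y, ENNReal.ofReal (Real.exp (4 * a * ∑ i : {i // i ∈ I}, ∑ k : {k // ¬ k ∈ I},
        (∑ l, U l i * U l k) * (y i * y k))) ∂(Measure.pi fun _ : ι => μ) ≤
      ENNReal.ofReal (Real.exp (64 * a ^ 2 * β ^ 2 * Fintype.card σ)) := by
  have hmp : MeasurePreserving (MeasurableEquiv.piEquivPiSubtypeProd (fun _ : ι => ℝ) (· ∈ I))
      (Measure.pi fun _ => μ) ((Measure.pi fun _ : {i // i ∈ I} => μ).prod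
        (Measure.pi fun _ : {k // ¬ k ∈ I} => μ)) := by
    convert measurePreserving_piEquivPiSubtypeProd (fun _ : ι => μ) (· ∈ I)
  let F : ({i // i ∈ I} → ℝ) × ({k // ¬ k ∈ I} → ℝ) → ENNReal := fun z =>
    ENNReal.ofReal (Real.exp (4 * a * ∑ i : {i // i ∈ I}, ∑ k : {k // ¬ k ∈ I},
        (∑ l, U l i * U l k) * (z.1 i * z.2 k)))
  have hF : Measurable F := by fun_prop
  have e1 := hmp.lintegral_comp hF
  refine (e1.trans (lintegral_prod_symm' _ hF)).trans_le ?_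
  have ha2 : (a * β) ^ 2 ≤ 1 / 128 := by
    rw [← sq_abs, abs_mul, abs_of_pos hβ]
    have := pow_le_pow_left₀ (by positivity) ha 2
    linarith
  have key : ∀ z : {k // ¬ k ∈ I} → ℝ,
      ∫⁻ y, F (y, z) ∂(Measure.pi fun _ : {i // i ∈ I} => μ) ≤
        ENNReal.ofReal (Real.exp (16 * a ^ 2 * β * ∑ l, (∑ k : {k // ¬ k ∈ I}, U l k * z k) ^ 2)) := by
    intro z
    have e2 : ∀ y : {i // i ∈ I} → ℝ, F (y, z) = ENNReal.ofReal (Real.exp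
        (∑ i : {i // i ∈ I}, (4 * a * ∑ l, (∑ k : {k // ¬ k ∈ I}, U l k * z k) * U l i) * y i)) := by
      intro y
      simp only [F]
      congr 2
      simp_rw [Finset.mul_sum, Finset.sum_mul, Finset.mul_sum, Finset.sum_mul]
      refine Finset.sum_congr rfl fun i _ => ?_
      rw [Finset.sum_comm]
      exact Finset.sum_congr rfl fun l _ => Finset.sum_congr rfl fun k _ => by ring
    simp_rw [e2]
    refine (lintegral_pi_exp_linear_le hβ h h0 _).trans
      (ENNReal.ofReal_le_ofReal (Real.exp_le_exp.mpr ?_))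
    simp_rw [mul_pow]
    rw [← Finset.mul_sum]
    have e3 : ∑ i : {i // i ∈ I}, (∑ l, (∑ k : {k // ¬ k ∈ I}, U l k * z k) * U l i) ^ 2 ≤
        ∑ l, (∑ k : {k // ¬ k ∈ I}, U l k * z k) ^ 2 := by
      rw [← hU, Finset.sum_coe_sort I fun i =>
        (∑ l, (∑ k : {k // ¬ k ∈ I}, U l k * z k) * U l i) ^ 2]
      exact Finset.sum_le_univ_sum_of_nonneg fun i => sq_nonneg _
    have := mul_le_mul_of_nonneg_left e3 (by positivity : 0 ≤ 16 * a ^ 2 * β)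
    linarith
  refine (lintegral_mono key).trans ?_
  refine (lintegral_exp_mul_sum_sq_le hβ h h0 (fun l (k : {k // ¬ k ∈ I}) => U l k) ?_
    (by positivity) (by nlinarith)).trans_eq ?_
  · intro g
    rw [← hU g]
    rw [← Finset.sum_subtype (Finset.univ.filter fun k => ¬ k ∈ I) (by simp)
      fun k => (∑ l, g l * U l k) ^ 2]
    exact Finset.sum_le_univ_sum_of_nonneg fun i => sq_nonneg _
  · ring_nf

lemma lintegral_exp_offDiag_le [DecidableEq ι]
    (hU : ∀ g : σ → ℝ, ∑ k, (∑ l, g l * U l k) ^ 2 = ∑ l, g l ^ 2)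
    (hβ : 0 < β) (h : ∫⁻ x, ENNReal.ofReal (Real.exp (x ^ 2 / β)) ∂μ ≤ 2)
    (h0 : ∫ x, x ∂μ = 0) {a : ℝ} (ha : |a| * β ≤ 1 / 12) :
    ∫⁻ y, ENNReal.ofReal (Real.exp (a * ∑ i, ∑ k,
        if i = k then 0 else (∑ l, U l i * U l k) * (y i * y k))) ∂(Measure.pi fun _ : ι => μ) ≤
      ENNReal.ofReal (Real.exp (64 * a ^ 2 * β ^ 2 * Fintype.card σ)) := by
  calc _ ≤ ∫⁻ y, ∑ I : Finset ι, ENNReal.ofReal ((2 : ℝ) ^ Fintype.card ι)⁻¹ *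
        ENNReal.ofReal (Real.exp (4 * a * ∑ i : {i // i ∈ I}, ∑ k : {k // ¬ k ∈ I},
          (∑ l, U l i * U l k) * (y i * y k))) ∂(Measure.pi fun _ : ι => μ) := by
        refine lintegral_mono fun y => ?_
        refine (ENNReal.ofReal_le_ofReal
          (exp_mul_offDiag_le (fun i k => (∑ l, U l i * U l k) * (y i * y k)) a)).trans_eq ?_
        rw [ENNReal.ofReal_sum_of_nonneg fun I _ => by positivity]
        exact Finset.sum_congr rfl fun I _ => ENNReal.ofReal_mul (by positivity)
    _ = ∑ I : Finset ι, ENNReal.ofReal ((2 : ℝ) ^ Fintype.card ι)⁻¹ *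
        ∫⁻ y, ENNReal.ofReal (Real.exp (4 * a * ∑ i : {i // i ∈ I}, ∑ k : {k // ¬ k ∈ I},
          (∑ l, U l i * U l k) * (y i * y k))) ∂(Measure.pi fun _ : ι => μ) := by
        rw [lintegral_finsetSum _ fun I _ => by fun_prop]
        exact Finset.sum_congr rfl fun I _ => lintegral_const_mul _ (by fun_prop)
    _ ≤ ∑ _I : Finset ι, ENNReal.ofReal ((2 : ℝ) ^ Fintype.card ι)⁻¹ *
        ENNReal.ofReal (Real.exp (64 * a ^ 2 * β ^ 2 * Fintype.card σ)) := by
        gcongr with I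
        exact lintegral_exp_block_le hU hβ h h0 ha I
    _ = _ := by
        rw [← Finset.sum_mul, ← ENNReal.ofReal_sum_of_nonneg fun I _ => by positivity]
        simp

/-- Diagonal and off-diagonal parts are recombined by `exp (x + y) ≤ (exp 2x + exp 2y) / 2`. -/
lemma lintegral_exp_mul_sum_sq_sub_le
    (hU : ∀ g : σ → ℝ, ∑ k, (∑ l, g l * U l k) ^ 2 = ∑ l, g l ^ 2)
    (hβ : 0 < β) (h : ∫⁻ x, ENNReal.ofReal (Real.exp (x ^ 2 / β)) ∂μ ≤ 2)
    (h0 : ∫ x, x ∂μ = 0) {m : ℝ} (hm : ∫ x, x ^ 2 ∂μ = m) {a : ℝ} (ha : |a| * β ≤ 1 / 24) :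
    ∫⁻ y, ENNReal.ofReal (Real.exp (a * (∑ l, (∑ k, U l k * y k) ^ 2 - Fintype.card σ * m)))
        ∂(Measure.pi fun _ : ι => μ) ≤
      ENNReal.ofReal (Real.exp (256 * a ^ 2 * β ^ 2 * Fintype.card σ)) := by
  classical
  have habs : |2 * a| * β ≤ 1 / 12 := by
    rw [abs_mul, abs_two]; linarith
  have hD := lintegral_exp_diag_le hU hβ h hm (a := 2 * a) (by linarith)
  have hO := lintegral_exp_offDiag_le hU hβ h h0 habs
  have split : ∀ y : ι → ℝ, ∑ l, (∑ k, U l k * y k) ^ 2 - Fintype.card σ * m =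
      ∑ i, (∑ l, U l i * U l i) * (y i ^ 2 - m) +
        ∑ i, ∑ k, if i = k then 0 else (∑ l, U l i * U l k) * (y i * y k) := by
    intro y
    have e1 : ∑ l, (∑ k, U l k * y k) ^ 2 = ∑ i, ∑ k, (∑ l, U l i * U l k) * (y i * y k) := by
      simp_rw [sq, Finset.sum_mul_sum, Finset.sum_mul]
      rw [Finset.sum_comm]
      refine Finset.sum_congr rfl fun i _ => ?_
      rw [Finset.sum_comm]
      exact Finset.sum_congr rfl fun k _ => Finset.sum_congr rfl fun l _ => by ring
    have e2 : ∀ i, ∑ k, (∑ l, U l i * U l k) * (y i * y k) =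
        (∑ l, U l i * U l i) * y i ^ 2 +
          ∑ k, if i = k then 0 else (∑ l, U l i * U l k) * (y i * y k) := by
      intro i
      have : ∀ k, (∑ l, U l i * U l k) * (y i * y k) =
          (if i = k then (∑ l, U l i * U l i) * y i ^ 2 else 0) +
          if i = k then 0 else (∑ l, U l i * U l k) * (y i * y k) := by
        intro k
        by_cases hik : i = k
        · subst hik
          simp only [if_true]
          ring
        · simp [hik]
      rw [Finset.sum_congr rfl fun k _ => this k, Finset.sum_add_distrib]
      congr 1
      simp
    rw [e1, ← sum_sum_sq_eq_card hU]
    simp_rw [e2, Finset.sum_add_distrib, mul_sub, Finset.sum_sub_distrib, ← Finset.sum_mul]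
    ring
  calc _ ≤ ∫⁻ y, (ENNReal.ofReal (1 / 2) * ENNReal.ofReal (Real.exp
          (∑ i, 2 * a * (∑ l, U l i * U l i) * (y i ^ 2 - m))) +
        ENNReal.ofReal (1 / 2) * ENNReal.ofReal (Real.exp (2 * a * ∑ i, ∑ k,
          if i = k then 0 else (∑ l, U l i * U l k) * (y i * y k))))
        ∂(Measure.pi fun _ : ι => μ) := by
        refine lintegral_mono fun y => ?_
        rw [← ENNReal.ofReal_mul (by norm_num), ← ENNReal.ofReal_mul (by norm_num),
          ← ENNReal.ofReal_add (by positivity) (by positivity)]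
        refine ENNReal.ofReal_le_ofReal ?_
        rw [split]
        simp_rw [mul_assoc (2 * a)]
        rw [← Finset.mul_sum]
        set x := ∑ i, (∑ l, U l i * U l i) * (y i ^ 2 - m)
        set z := ∑ i, ∑ k, if i = k then 0 else (∑ l, U l i * U l k) * (y i * y k)
        rw [mul_add, Real.exp_add, mul_assoc 2, mul_assoc 2, two_mul (a * x), two_mul (a * z),
          Real.exp_add, Real.exp_add]
        nlinarith [sq_nonneg (Real.exp (a * x) - Real.exp (a * z))]
    _ ≤ ENNReal.ofReal (1 / 2) *
          ENNReal.ofReal (Real.exp (44 * (2 * a) ^ 2 * β ^ 2 * Fintype.card σ)) +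
        ENNReal.ofReal (1 / 2) *
          ENNReal.ofReal (Real.exp (64 * (2 * a) ^ 2 * β ^ 2 * Fintype.card σ)) := by
        rw [lintegral_add_left (by fun_prop), lintegral_const_mul _ (by fun_prop),
          lintegral_const_mul' _ _ (by simp)]
        gcongr
    _ ≤ _ := by
        rw [← ENNReal.ofReal_mul (by norm_num), ← ENNReal.ofReal_mul (by norm_num),
          ← ENNReal.ofReal_add (by positivity) (by positivity)]
        refine ENNReal.ofReal_le_ofReal ?_
        have hp : 0 ≤ a ^ 2 * β ^ 2 * Fintype.card σ := by positivity
        have e1 : Real.exp (44 * (2 * a) ^ 2 * β ^ 2 * Fintype.card σ) ≤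
            Real.exp (256 * a ^ 2 * β ^ 2 * Fintype.card σ) :=
          Real.exp_le_exp.mpr (by nlinarith)
        have e2 : Real.exp (64 * (2 * a) ^ 2 * β ^ 2 * Fintype.card σ) =
            Real.exp (256 * a ^ 2 * β ^ 2 * Fintype.card σ) := by ring_nf
        rw [e2]
        linarith

/-- The Chernoff bound, in exponential form. -/
lemma measure_lt_le_of_lintegral_exp_le {Ω : Type*} [MeasurableSpace Ω] {P : Measure Ω}
    {Z : Ω → ℝ} (hZ : Measurable Z) {a b t : ℝ} (ha : 0 ≤ a)
    (h : ∫⁻ ω, ENNReal.ofReal (Real.exp (a * Z ω)) ∂P ≤ ENNReal.ofReal (Real.exp b)) :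
    P {ω | t < Z ω} ≤ ENNReal.ofReal (Real.exp (b - a * t)) := by
  calc P {ω | t < Z ω}
      ≤ P {ω | ENNReal.ofReal (Real.exp (a * t)) ≤ ENNReal.ofReal (Real.exp (a * Z ω))} := by
        refine measure_mono fun ω hω => ?_
        exact ENNReal.ofReal_le_ofReal
          (Real.exp_le_exp.mpr (mul_le_mul_of_nonneg_left (le_of_lt hω) ha))
    _ ≤ (∫⁻ ω, ENNReal.ofReal (Real.exp (a * Z ω)) ∂P) / ENNReal.ofReal (Real.exp (a * t)) :=
        meas_ge_le_lintegral_div (by fun_prop) (by simp [Real.exp_pos]) (by simp)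
    _ ≤ ENNReal.ofReal (Real.exp b) / ENNReal.ofReal (Real.exp (a * t)) := by gcongr
    _ = _ := by
        rw [← ENNReal.ofReal_div_of_pos (Real.exp_pos _), Real.exp_sub]

/-- The Hanson–Wright inequality for an orthogonal projection `Uᵀ U` of positive rank. -/
theorem measure_abs_sum_sq_sub_gt_le [Nonempty σ]
    (hU : ∀ g : σ → ℝ, ∑ k, (∑ l, g l * U l k) ^ 2 = ∑ l, g l ^ 2)
    (hβ : 0 < β) (h : ∫⁻ x, ENNReal.ofReal (Real.exp (x ^ 2 / β)) ∂μ ≤ 2)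
    (h0 : ∫ x, x ∂μ = 0) {m : ℝ} (hm : ∫ x, x ^ 2 ∂μ = m) {t : ℝ} (ht : 0 < t) :
    (Measure.pi fun _ : ι => μ)
        {y | t < |∑ l, (∑ k, U l k * y k) ^ 2 - Fintype.card σ * m|} ≤
      ENNReal.ofReal (2 * Real.exp (-(1 / 1024) *
        min (t ^ 2 / (β ^ 2 * Fintype.card σ)) (t / β))) := by
  have hd : (0 : ℝ) < Fintype.card σ := by exact_mod_cast Fintype.card_pos
  set d : ℝ := (Fintype.card σ : ℝ)
  -- Up to truncation at `1 / (24 β)`, `a` minimizes the exponent `256 a² β² d - a t`.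
  obtain ⟨a, ha0, ha, hexp⟩ : ∃ a : ℝ, 0 ≤ a ∧ a * β ≤ 1 / 24 ∧
      256 * a ^ 2 * β ^ 2 * d - a * t ≤
        -(1 / 1024) * min (t ^ 2 / (β ^ 2 * d)) (t / β) := by
    rcases le_total (t / (512 * β * d)) (1 / 24) with h1 | h1
    · refine ⟨t / (512 * β ^ 2 * d), by positivity, ?_, ?_⟩
      · have : t / (512 * β ^ 2 * d) * β = t / (512 * β * d) := by field_simp
        rwa [this]
      · have e : 256 * (t / (512 * β ^ 2 * d)) ^ 2 * β ^ 2 * d - t / (512 * β ^ 2 * d) * t =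
            -(1 / 1024) * (t ^ 2 / (β ^ 2 * d)) := by
          field_simp
          norm_num
        rw [e]
        have := min_le_left (t ^ 2 / (β ^ 2 * d)) (t / β)
        linarith
    · refine ⟨1 / (24 * β), by positivity, ?_, ?_⟩
      · have : 1 / (24 * β) * β = 1 / 24 := by field_simp
        rw [this]
      · have e : 256 * (1 / (24 * β)) ^ 2 * β ^ 2 * d - 1 / (24 * β) * t =
            4 / 9 * d - 1 / 24 * (t / β) := by
          field_simp
          ring
        have h2 : 512 * d ≤ 24 * (t / β) := by
          rw [le_div_iff₀ (by positivity)] at h1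
          rw [← mul_div_assoc, le_div_iff₀ hβ]
          linarith
        have h3 : 0 < t / β := by positivity
        have := min_le_right (t ^ 2 / (β ^ 2 * d)) (t / β)
        rw [e]
        linarith
  have habs : |a| * β ≤ 1 / 24 := by rwa [abs_of_nonneg ha0]
  have habs' : |-a| * β ≤ 1 / 24 := by rwa [abs_neg]
  have up := lintegral_exp_mul_sum_sq_sub_le hU hβ h h0 hm habs
  have lo := lintegral_exp_mul_sum_sq_sub_le hU hβ h h0 hm habs'
  simp_rw [neg_mul_comm a, neg_sq] at lo
  have hup := measure_lt_le_of_lintegral_exp_le (t := t) (by fun_prop) ha0 up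
  have hlo := measure_lt_le_of_lintegral_exp_le (t := t) (by fun_prop) ha0 lo
  calc (Measure.pi fun _ : ι => μ) {y | t < |∑ l, (∑ k, U l k * y k) ^ 2 - d * m|}
      ≤ (Measure.pi fun _ : ι => μ) ({y | t < ∑ l, (∑ k, U l k * y k) ^ 2 - d * m} ∪
        {y | t < -(∑ l, (∑ k, U l k * y k) ^ 2 - d * m)}) :=
        measure_mono fun y (hy : t < |_|) => lt_abs.mp hy
    _ ≤ _ := (measure_union_le _ _).trans (add_le_add hup hlo)
    _ ≤ _ := by
        rw [← ENNReal.ofReal_add (Real.exp_pos _).le (Real.exp_pos _).le, ← two_mul]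
        refine ENNReal.ofReal_le_ofReal (mul_le_mul_of_nonneg_left ?_ zero_le_two)
        exact Real.exp_le_exp.mpr hexp

end HansonWright

/-! ### From the subgaussian norm to a square-exponential moment -/

/-- The moment bound at `p = 2k` contained in the subgaussian norm. -/
lemma lintegral_pow_two_mul_le_of_psi2Norm_le {Ω : Type*} [MeasurableSpace Ω] {P : Measure Ω}
    {X : Ω → ℝ} {B : ℝ} (hB : 0 < B) (h : psi2Norm X P ≤ ENNReal.ofReal B) {k : ℕ} (hk : 1 ≤ k) :
    ∫⁻ ω, ENNReal.ofReal (X ω ^ (2 * k)) ∂P ≤ ENNReal.ofReal ((2 * k * B ^ 2) ^ k) := by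
  have hk' : (1 : ℝ) ≤ k := by exact_mod_cast hk
  have hp : (0 : ℝ) < 2 * k := by linarith
  have h1 : ENNReal.ofReal ((2 * k : ℝ) ^ (-(1 / 2) : ℝ)) *
      eLpNorm X (ENNReal.ofReal (2 * k)) P ≤ ENNReal.ofReal B :=
    (le_iSup₂ (f := fun (p : ℝ) (_ : 1 ≤ p) => ENNReal.ofReal (p ^ (-(1 / 2) : ℝ)) *
      eLpNorm X (ENNReal.ofReal p) P) (2 * k : ℝ) (by linarith)).trans h
  have hc : (0 : ℝ) < (2 * k : ℝ) ^ (-(1 / 2) : ℝ) := Real.rpow_pos_of_pos hp _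
  have h2 : eLpNorm X (ENNReal.ofReal (2 * k)) P ≤ ENNReal.ofReal (√(2 * k) * B) := by
    have e : √(2 * k) * B = B / (2 * k : ℝ) ^ (-(1 / 2) : ℝ) := by
      rw [Real.rpow_neg hp.le, ← Real.sqrt_eq_rpow, div_inv_eq_mul, mul_comm]
    rw [e, ENNReal.ofReal_div_of_pos hc]
    rw [ENNReal.le_div_iff_mul_le (Or.inl (by simpa using hc)) (Or.inl (by simp)), mul_comm]
    exact h1
  rw [eLpNorm_eq_lintegral_rpow_enorm_toReal (ENNReal.ofReal_pos.mpr hp).ne'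
    ENNReal.ofReal_ne_top, ENNReal.toReal_ofReal hp.le, one_div,
    ENNReal.rpow_inv_le_iff hp] at h2
  have hcast : (2 * k : ℝ) = ((2 * k : ℕ) : ℝ) := by push_cast; rfl
  calc ∫⁻ ω, ENNReal.ofReal (X ω ^ (2 * k)) ∂P = ∫⁻ ω, ‖X ω‖ₑ ^ (2 * k : ℝ) ∂P := by
        refine lintegral_congr fun ω => ?_
        rw [hcast, ENNReal.rpow_natCast, Real.enorm_eq_ofReal_abs,
          ← ENNReal.ofReal_pow (abs_nonneg _), (even_two_mul k).pow_abs]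
    _ ≤ ENNReal.ofReal (√(2 * k) * B) ^ (2 * k : ℝ) := h2
    _ = ENNReal.ofReal ((√(2 * k) * B) ^ (2 * k)) := by
        conv_lhs => rw [hcast, ENNReal.rpow_natCast]
        rw [ENNReal.ofReal_pow (by positivity)]
        push_cast
        rfl
    _ = ENNReal.ofReal ((2 * k * B ^ 2) ^ k) := by
        rw [pow_mul, mul_pow, Real.sq_sqrt hp.le]

lemma lintegral_exp_sq_div_le_of_psi2Norm_le {Ω : Type*} [MeasurableSpace Ω] {P : Measure Ω}
    [IsProbabilityMeasure P] {X : Ω → ℝ} (hX : AEMeasurable X P) {B : ℝ} (hB : 0 < B)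
    (h : psi2Norm X P ≤ ENNReal.ofReal B) :
    ∫⁻ ω, ENNReal.ofReal (Real.exp (X ω ^ 2 / (12 * B ^ 2))) ∂P ≤ 2 := by
  have hexp : ∀ ω, ENNReal.ofReal (Real.exp (X ω ^ 2 / (12 * B ^ 2))) =
      ∑' k : ℕ, ENNReal.ofReal ((12 * B ^ 2) ^ k * k.factorial)⁻¹ *
        ENNReal.ofReal (X ω ^ (2 * k)) := by
    intro ω
    have hs := NormedSpace.expSeries_div_hasSum_exp (X ω ^ 2 / (12 * B ^ 2))
    rw [← Real.exp_eq_exp_ℝ] at hs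
    rw [← hs.tsum_eq, ENNReal.ofReal_tsum_of_nonneg (fun k => by positivity) hs.summable]
    refine tsum_congr fun k => ?_
    rw [← ENNReal.ofReal_mul (by positivity)]
    congr 1
    rw [div_pow, pow_mul, div_div, div_eq_inv_mul]
  simp_rw [hexp]
  rw [lintegral_tsum fun k => by fun_prop]
  calc _ ≤ ∑' k : ℕ, ENNReal.ofReal ((1 / 2) ^ k) := by
        refine ENNReal.tsum_le_tsum fun k => ?_
        rw [lintegral_const_mul'' _ (by fun_prop)]
        rcases Nat.eq_zero_or_pos k with rfl | hk
        · simp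
        · refine (mul_le_mul_right (lintegral_pow_two_mul_le_of_psi2Norm_le hB h hk) _).trans ?_
          rw [← ENNReal.ofReal_mul (by positivity)]
          refine ENNReal.ofReal_le_ofReal ?_
          -- `k ^ k / k! ≤ e ^ k ≤ 3 ^ k`, and `3 * (2 / 12) = 1 / 2`.
          have e1 : ((k : ℝ) ^ k / k.factorial) ≤ 3 ^ k := by
            refine (Real.pow_div_factorial_le_exp _ (Nat.cast_nonneg k) k).trans ?_
            rw [← mul_one (k : ℝ), Real.exp_nat_mul]
            exact pow_le_pow_left₀ (Real.exp_pos _).le Real.exp_one_lt_three.le k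
          have e2 : ((12 * B ^ 2) ^ k * (k.factorial : ℝ))⁻¹ * (2 * k * B ^ 2) ^ k =
              (1 / 6) ^ k * ((k : ℝ) ^ k / k.factorial) := by
            have e3 : (2 * k * B ^ 2) ^ k = (12 * B ^ 2) ^ k * ((1 / 6) ^ k * (k : ℝ) ^ k) := by
              rw [← mul_pow, ← mul_pow]; ring
            rw [e3]
            field_simp
          rw [e2]
          calc (1 / 6 : ℝ) ^ k * ((k : ℝ) ^ k / k.factorial) ≤ (1 / 6) ^ k * 3 ^ k :=
                mul_le_mul_of_nonneg_left e1 (by positivity)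
            _ = (1 / 2) ^ k := by rw [← mul_pow]; norm_num
    _ = 2 := by
        rw [← ENNReal.ofReal_tsum_of_nonneg (fun k => by positivity) summable_geometric_two,
          tsum_geometric_two]
        simp

/-! ### The distance to the span of the other columns -/

/-- The squared distance to a subspace `K` of Euclidean space, in coordinates with respect to an
orthonormal basis of `Kᗮ`. -/
lemma exists_coisometry_norm_sub_starProjection_sq {ι : Type*} [Fintype ι]
    (K : Submodule ℝ (EuclideanSpace ℝ ι)) :
    ∃ U : Fin (Module.finrank ℝ Kᗮ) → ι → ℝ,
      (∀ g : Fin (Module.finrank ℝ Kᗮ) → ℝ, ∑ k, (∑ l, g l * U l k) ^ 2 = ∑ l, g l ^ 2) ∧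
      ∀ x : EuclideanSpace ℝ ι, ‖x - K.starProjection x‖ ^ 2 = ∑ l, (∑ k, U l k * x k) ^ 2 := by
  let b := stdOrthonormalBasis ℝ Kᗮ
  refine ⟨fun l k => (b l : EuclideanSpace ℝ ι) k, fun g => ?_, fun x => ?_⟩
  · have e1 : ‖∑ l, g l • b l‖ ^ 2 = ∑ l, g l ^ 2 := by
      rw [← real_inner_self_eq_norm_sq, b.orthonormal.inner_sum]
      simp [sq]
    have e2 : ‖((∑ l, g l • b l : Kᗮ) : EuclideanSpace ℝ ι)‖ ^ 2 =
        ∑ k, (∑ l, g l * (b l : EuclideanSpace ℝ ι) k) ^ 2 := by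
      rw [EuclideanSpace.norm_sq_eq]
      simp
    rw [← e2, ← e1, Submodule.coe_norm]
  · have e1 : x - K.starProjection x = (Kᗮ.orthogonalProjectionOnto x : EuclideanSpace ℝ ι) := by
      rw [← Submodule.starProjection_apply, Submodule.starProjection_orthogonal']
      simp
    rw [e1, ← Submodule.coe_norm, ← b.sum_sq_norm_inner_right]
    refine Finset.sum_congr rfl fun l _ => ?_
    rw [Submodule.inner_orthogonalProjectionOnto_eq_of_mem_left, Real.norm_eq_abs, sq_abs]
    congr 1
    simp [PiLp.inner_apply, mul_comm]

/-- As an infimum of continuous functions of the matrix, the distance is upper semicontinuous. -/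
lemma measurable_Rnn {T n : ℕ} (j : Fin n) :
    Measurable fun a : Fin T × Fin n → ℝ => Rnn (Matrix.of fun i k => a (i, k)) j := by
  have e : ∀ a : Fin T × Fin n → ℝ, Rnn (Matrix.of fun i k => a (i, k)) j =
      ⨅ r : {k : Fin n // k ≠ j} → ℝ, ‖euclideanCol (Matrix.of fun i k => a (i, k)) j -
        ∑ k, r k • euclideanCol (Matrix.of fun i k => a (i, k)) k.1‖ := by
    intro a
    let f : ({k : Fin n // k ≠ j} → ℝ) → otherColSpace (Matrix.of fun i k => a (i, k)) j :=
      fun r => ⟨∑ k, r k • euclideanCol (Matrix.of fun i k => a (i, k)) k.1,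
        (Submodule.mem_span_range_iff_exists_fun ℝ).mpr ⟨r, rfl⟩⟩
    have hf : Function.Surjective f := fun ⟨x, hx⟩ => by
      obtain ⟨r, hr⟩ := (Submodule.mem_span_range_iff_exists_fun ℝ).mp hx
      exact ⟨r, Subtype.ext hr⟩
    rw [Rnn, Submodule.starProjection_minimal, ← hf.iInf_comp]
  simp_rw [e]
  refine (upperSemicontinuous_ciInf (fun a => ⟨0, ?_⟩) fun r => ?_).measurable
  · rintro _ ⟨r, rfl⟩
    exact norm_nonneg _
  · refine Continuous.upperSemicontinuous ?_
    unfold euclideanCol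
    simp only [Matrix.of_apply]
    fun_prop

lemma finrank_orthogonal_otherColSpace {T n : ℕ} (hnT : n ≤ T) {A : Matrix (Fin T) (Fin n) ℝ}
    {j : Fin n}
    (hA : LinearIndependent ℝ fun k : {k : Fin n // k ≠ j} => euclideanCol A k.1) :
    Module.finrank ℝ (otherColSpace A j)ᗮ = T - n + 1 := by
  have h1 := (otherColSpace A j).finrank_add_finrank_orthogonal
  have h2 : Module.finrank ℝ (otherColSpace A j) = n - 1 := by
    rw [otherColSpace, finrank_span_eq_card hA]
    simp
  rw [h2, finrank_euclideanSpace, Fintype.card_fin] at h1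
  have := j.pos
  omega

/-! ### Conditioning on the other columns -/

/-- The Hanson–Wright inequality for the distance from a random vector `x ∘ e`, where `x` has
independent coordinates with law `μ`, to a fixed subspace of positive codimension. -/
lemma measure_abs_norm_sub_starProjection_sq_sub_gt_le {μ : Measure ℝ} [IsProbabilityMeasure μ]
    {β : ℝ} (hβ : 0 < β) (h : ∫⁻ x, ENNReal.ofReal (Real.exp (x ^ 2 / β)) ∂μ ≤ 2)
    (h0 : ∫ x, x ∂μ = 0) {m : ℝ} (hm : ∫ x, x ^ 2 ∂μ = m)
    {ι ι' : Type*} [Fintype ι] [Fintype ι'] (e : ι ≃ ι')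
    (K : Submodule ℝ (EuclideanSpace ℝ ι)) (hK : 0 < Module.finrank ℝ Kᗮ) {t : ℝ} (ht : 0 < t) :
    (Measure.pi fun _ : ι' => μ) {x | t < |‖WithLp.toLp 2 (x ∘ e) -
        K.starProjection (WithLp.toLp 2 (x ∘ e))‖ ^ 2 - Module.finrank ℝ Kᗮ * m|} ≤
      ENNReal.ofReal (2 * Real.exp (-(1 / 1024) *
        min (t ^ 2 / (β ^ 2 * Module.finrank ℝ Kᗮ)) (t / β))) := by
  obtain ⟨U, hU, hUx⟩ := exists_coisometry_norm_sub_starProjection_sq K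
  have : Nonempty (Fin (Module.finrank ℝ Kᗮ)) := ⟨⟨0, hK⟩⟩
  have hU' : ∀ g : Fin (Module.finrank ℝ Kᗮ) → ℝ,
      ∑ k, (∑ l, g l * U l (e.symm k)) ^ 2 = ∑ l, g l ^ 2 := fun g => by
    rw [← hU g]
    exact e.symm.sum_comp fun k => (∑ l, g l * U l k) ^ 2
  have key := measure_abs_sum_sq_sub_gt_le hU' hβ h h0 hm ht
  rw [Fintype.card_fin] at key
  convert key using 5 with x
  simp only [hUx]
  congr! 6 with l
  rw [← e.sum_comp]
  simp

theorem proposition2p2 :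
    ∃ c : ℝ, 0 < c ∧
      ∀ (Ω : Type*) [MeasurableSpace Ω] (P : Measure Ω) [IsProbabilityMeasure P]
        (T n : ℕ) (_ : n ≤ T) (j : Fin n)
        (L : Ω → Matrix (Fin T) (Fin n) ℝ) (v B : ℝ) (_ : 0 < B)
        -- the entries of `L` are independent and identically distributed
        (_ : iIndepFun (fun (ik : Fin T × Fin n) (ω : Ω) => L ω ik.1 ik.2) P)
        (_ : ∀ ik ik' : Fin T × Fin n,
          IdentDistrib (fun ω => L ω ik.1 ik.2) (fun ω => L ω ik'.1 ik'.2) P P)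
        -- with mean zero, variance `v²` and subgaussian norm at most `B`
        (_ : ∀ i k, ∫ ω, L ω i k ∂P = 0)
        (_ : ∀ i k, variance (fun ω => L ω i k) P = v ^ 2)
        (_ : ∀ i k, psi2Norm (fun ω => L ω i k) P ≤ ENNReal.ofReal B)
        -- almost surely, the columns other than the `j`-th are linearly independent
        (_ : ∀ᵐ ω ∂P, LinearIndependent ℝ (fun k : {k : Fin n // k ≠ j} => euclideanCol (L ω) k.1))
        (t : ℝ) (_ : 0 < t),
        P.real {ω | t < |Rnn (L ω) j ^ 2 - ((T : ℝ) - n + 1) * v ^ 2|} ≤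
          2 * Real.exp (-c * min (t ^ 2 / (B ^ 4 * ((T : ℝ) - n + 1))) (t / B ^ 2)) := by
  refine ⟨1 / (1024 * 144), by norm_num, ?_⟩
  intro Ω _ P _ T n hnT j L v B hB hind hid hmean hvar hpsi hli t ht
  have i₀ : Fin T := ⟨0, j.pos.trans_le hnT⟩
  have hmeas : ∀ ik : Fin T × Fin n, AEMeasurable (fun ω => L ω ik.1 ik.2) P := fun ik =>
    (hid ik ik).aemeasurable_fst
  set X : Ω → ℝ := fun ω => L ω i₀ j
  have hX : AEMeasurable X P := hmeas (i₀, j)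
  set μ : Measure ℝ := P.map X
  have hμ : IsProbabilityMeasure μ := Measure.isProbabilityMeasure_map hX
  have hβ : 0 < 12 * B ^ 2 := by positivity
  have hexp : ∫⁻ x, ENNReal.ofReal (Real.exp (x ^ 2 / (12 * B ^ 2))) ∂μ ≤ 2 := by
    rw [lintegral_map' (by fun_prop) hX]
    exact lintegral_exp_sq_div_le_of_psi2Norm_le hX hB (hpsi i₀ j)
  have h0 : ∫ x, x ∂μ = 0 := by
    rw [integral_map hX (by fun_prop)]
    exact hmean i₀ j
  have hm : ∫ x, x ^ 2 ∂μ = v ^ 2 := by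
    rw [integral_map hX (by fun_prop), ← hvar i₀ j]
    exact (variance_of_integral_eq_zero hX (hmean i₀ j)).symm
  -- The joint law of any subfamily of the entries is a product of copies of `μ`.
  have hlaw : ∀ {κ : Type} [Fintype κ] (f : κ → Fin T × Fin n), f.Injective →
      P.map (fun ω s => L ω (f s).1 (f s).2) = Measure.pi fun _ : κ => μ := by
    intro κ _ f hf
    have h1 := (iIndepFun_iff_map_fun_eq_pi_map fun s => hmeas (f s)).mp (hind.precomp hf)
    have h2 : ∀ s, P.map (fun ω => L ω (f s).1 (f s).2) = μ := fun s =>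
      (hid (f s) (i₀, j)).map_eq
    rw [h1]
    simp_rw [h2]
  let p : Fin T × Fin n → Prop := fun ik => ik.2 = j
  let e : Fin T ≃ {ik : Fin T × Fin n // p ik} :=
    { toFun := fun i => ⟨(i, j), rfl⟩
      invFun := fun s => s.1.1
      left_inv := fun i => rfl
      right_inv := fun ⟨⟨i, k⟩, hk⟩ => by
        have : k = j := hk
        subst this
        rfl }
  -- The law of the entries outside the `j`-th column gives linear independence almost surely.
  have hae : ∀ᵐ z ∂(Measure.pi fun _ : {ik : Fin T × Fin n // ¬ p ik} => μ),
      LinearIndependent ℝ fun k : {k : Fin n // k ≠ j} =>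
        (WithLp.toLp 2 fun i => z ⟨(i, k.1), k.2⟩ : EuclideanSpace ℝ (Fin T)) := by
    rw [← hlaw Subtype.val Subtype.val_injective, ae_map_iff]
    · exact hli
    · exact aemeasurable_pi_lambda _ fun s => hmeas s.1
    · have hc : Continuous fun (z : {ik : Fin T × Fin n // ¬ p ik} → ℝ)
          (k : {k : Fin n // k ≠ j}) =>
          (WithLp.toLp 2 fun i => z ⟨(i, k.1), k.2⟩ : EuclideanSpace ℝ (Fin T)) := by
        fun_prop
      exact (isOpen_setOfPred_linearIndependent.preimage hc).measurableSet
  set d : ℝ := (T : ℝ) - n + 1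
  have hd : 0 < d := by
    have : (n : ℝ) ≤ T := by exact_mod_cast hnT
    linarith
  let S : Set (Fin T × Fin n → ℝ) :=
    {a | t < |Rnn (Matrix.of fun i k => a (i, k)) j ^ 2 - d * v ^ 2|}
  have hS : MeasurableSet S := by
    have := measurable_Rnn (T := T) j
    exact measurableSet_lt measurable_const (by fun_prop)
  have hmp := (measurePreserving_piEquivPiSubtypeProd (fun _ : Fin T × Fin n => μ) p).symm
  have hPS : P {ω | t < |Rnn (L ω) j ^ 2 - d * v ^ 2|} = (Measure.pi fun _ => μ) S := by
    rw [← hlaw id Function.injective_id, Measure.map_apply_of_aemeasurable _ hS]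
    · rfl
    · exact aemeasurable_pi_lambda _ hmeas
  refine ENNReal.toReal_le_of_le_ofReal (by positivity) ?_
  rw [hPS, ← hmp.measure_preimage hS.nullMeasurableSet,
    Measure.prod_apply_symm (hmp.measurable hS)]
  have hslice : ∀ᵐ z ∂(Measure.pi fun _ : {ik : Fin T × Fin n // ¬ p ik} => μ),
      (Measure.pi fun _ : {ik : Fin T × Fin n // p ik} => μ) ((fun x => (x, z)) ⁻¹'
        ((MeasurableEquiv.piEquivPiSubtypeProd (fun _ : Fin T × Fin n => ℝ) p).symm ⁻¹' S)) ≤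
      ENNReal.ofReal (2 * Real.exp (-(1 / 1024) *
        min (t ^ 2 / ((12 * B ^ 2) ^ 2 * d)) (t / (12 * B ^ 2)))) := by
    filter_upwards [hae] with z hz
    -- The matrix with the given other columns and `j`-th column zero.
    let A : Matrix (Fin T) (Fin n) ℝ := Matrix.of fun i k =>
      if hk : k = j then 0 else z ⟨(i, k), hk⟩
    have hcol : ∀ k : {k : Fin n // k ≠ j},
        euclideanCol A k.1 = WithLp.toLp 2 fun i => z ⟨(i, k.1), k.2⟩ := by
      intro k
      ext i
      simp [euclideanCol, A, k.2]
    have hA : LinearIndependent ℝ fun k : {k : Fin n // k ≠ j} => euclideanCol A k.1 := by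
      simp_rw [hcol]
      exact hz
    have hrank := finrank_orthogonal_otherColSpace hnT hA
    have hrank' : (Module.finrank ℝ (otherColSpace A j)ᗮ : ℝ) = d := by
      rw [hrank]
      push_cast [Nat.cast_sub hnT]
      rfl
    have key := measure_abs_norm_sub_starProjection_sq_sub_gt_le hβ hexp h0 hm e
      (otherColSpace A j) (by omega) ht
    rw [hrank'] at key
    refine le_of_eq_of_le (congrArg _ ?_) key
    ext x
    let M : Matrix (Fin T) (Fin n) ℝ := Matrix.of fun i k =>
      (MeasurableEquiv.piEquivPiSubtypeProd (fun _ : Fin T × Fin n => ℝ) p).symm (x, z) (i, k)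
    have hM : ∀ i k, M i k = if hk : k = j then x ⟨(i, k), hk⟩ else z ⟨(i, k), hk⟩ :=
      fun i k => rfl
    have hMj : euclideanCol M j = WithLp.toLp 2 (x ∘ e) := by
      ext i
      simp [euclideanCol, hM, e]
    have hMo : otherColSpace M j = otherColSpace A j := by
      unfold otherColSpace
      congr 2
      funext k
      rw [hcol]
      ext i
      simp [euclideanCol, hM, k.2]
    change t < |Rnn M j ^ 2 - d * v ^ 2| ↔ _
    simp only [Rnn, hMj, hMo]
    rfl
  refine (lintegral_mono_ae hslice).trans ?_
  rw [lintegral_const, measure_univ, mul_one]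
  refine ENNReal.ofReal_le_ofReal (mul_le_mul_of_nonneg_left (Real.exp_le_exp.mpr ?_) zero_le_two)
  have e1 : t ^ 2 / ((12 * B ^ 2) ^ 2 * d) = 1 / 144 * (t ^ 2 / (B ^ 4 * d)) := by
    field_simp
    norm_num
  have e2 : 1 / 144 * (t / B ^ 2) ≤ t / (12 * B ^ 2) := by
    have e3 : t / (12 * B ^ 2) = 1 / 12 * (t / B ^ 2) := by field_simp
    rw [e3]
    exact mul_le_mul_of_nonneg_right (by norm_num) (by positivity)
  have e4 : 1 / 144 * min (t ^ 2 / (B ^ 4 * d)) (t / B ^ 2) ≤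
      min (t ^ 2 / ((12 * B ^ 2) ^ 2 * d)) (t / (12 * B ^ 2)) := by
    rw [e1]
    refine le_min ?_ (le_trans ?_ e2)
    · exact mul_le_mul_of_nonneg_left (min_le_left _ _) (by norm_num)
    · exact mul_le_mul_of_nonneg_left (min_le_right _ _) (by norm_num)
  linarith
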